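/- Let $a_0\in\mathbb{R}$ with $|a_0|>1$, let $\sigma>0$, let $e_1,e_2,\dots$ be a Gaussian white noise of variance $\sigma^2$ (independent $\mathcal{N}(0,\sigma^2)$ random variables), and let $\{y_t\}$ be the unstable AR(1) process $y_t=a_0y_{t-1}+e_t$, $t\ge 1$, with $y_0=0$. For $N\ge 2$ let $$\hat a_N:=\frac{\sum_{t=2}^{N}y_ty_{t-1}}{\sum_{t=1}^{N-1}y_t^2}$$ be the least squares estimate of $a_0$, and let $\mathrm{var}\{\hat a_N\}:=\mathbb{E}[(\hat a_N-a_0)^2]$. Then for every $\varepsilon>0$ and every $N\ge 2$, $$\mathbb{P}(\hat a_N-a_0>\varepsilon)\le\left(\frac{\lambda_2-\lambda_1}{(\lambda_2-1)\lambda_1^{N}-(\lambda_1-1)\lambda_2^{N}}\right)^{1/4},$$ where $$\lambda_{1,2}=\frac{1+a_0^2+\varepsilon^2}{2}\mp\frac{\sqrt{(1+a_0^2+\varepsilon^2)^2-4a_0^2}}{2},\qquad \lambda_1<\lambda_2,$$ are the roots of $\lambda^2-(1+a_0^2+\varepsilon^2)\lambda+a_0^2$. Furthermore, for every $N\ge 7$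 the variance $\mathrm{var}\{\hat a_N\}$ is finite and $$\mathrm{var}\{\hat a_N\}\le |a_0|^{-\frac{2N}{5}}\left[\frac{2a_0^4(N+5)}{N}+8\sqrt[4]{\frac{N}{N+5}}\left(\frac{a_0^2}{N-6}-\frac{1}{N+2}\right)\right].$$ In particular the variance decays exponentially in $N$: there is a constant $C$ with $\mathrm{var}\{\hat a_N\}\le C\,|a_0|^{-2N/5}$ for all $N\ge 7$. -/

import Mathlib

open MeasureTheory ProbabilityTheory
open scoped NNReal

namespace AR1

noncomputable section

/-- A Gaussian white noise of variance `σ ^ 2`: independent `N(0, σ ^ 2)` random variables. -/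
structure IsGaussianWhiteNoise {ι Ω : Type*} [MeasurableSpace Ω] (μ : Measure Ω) (σ : ℝ≥0)
    (e : ι → Ω → ℝ) : Prop where
  measurable : ∀ i, Measurable (e i)
  indep : iIndepFun e μ
  law : ∀ i, HasLaw (e i) (gaussianReal 0 (σ ^ 2)) μ

/-- The AR(1) process `y_t = a₀ y_{t-1} + e_t` for `t ≥ 1`, started at `y_0 = 0` and driven by a
Gaussian white noise `e_1, e_2, …` of variance `σ ^ 2`. The value `e 0` is not used. -/
structure IsProcess {Ω : Type*} [MeasurableSpace Ω] (μ : Measure Ω) (a₀ : ℝ) (σ : ℝ≥0)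
    (e y : ℕ → Ω → ℝ) : Prop where
  noise : IsGaussianWhiteNoise μ σ (fun t : ℕ => e (t + 1))
  init : ∀ ω, y 0 ω = 0
  step : ∀ t ω, y (t + 1) ω = a₀ * y t ω + e (t + 1) ω

/-- The least squares estimate of `a₀` from the data `y_1, …, y_N`. -/
def lsEstimate {Ω : Type*} (y : ℕ → Ω → ℝ) (N : ℕ) (ω : Ω) : ℝ :=
  (∑ t ∈ Finset.Icc 2 N, y t ω * y (t - 1) ω) / ∑ t ∈ Finset.Icc 1 (N - 1), y t ω ^ 2

/-- The variance of the estimate about the true value, `𝔼[(â_N - a₀) ^ 2]`. -/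
def lsVariance {Ω : Type*} [MeasurableSpace Ω] (μ : Measure Ω) (a₀ : ℝ) (y : ℕ → Ω → ℝ)
    (N : ℕ) : ℝ :=
  ∫ ω, (lsEstimate y N ω - a₀) ^ 2 ∂μ

/-- The smaller root of `λ² - (1 + a₀² + ε²) λ + a₀²`. -/
def root₁ (a₀ ε : ℝ) : ℝ :=
  (1 + a₀ ^ 2 + ε ^ 2) / 2 - √((1 + a₀ ^ 2 + ε ^ 2) ^ 2 - 4 * a₀ ^ 2) / 2

/-- The larger root of `λ² - (1 + a₀² + ε²) λ + a₀²`. -/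
def root₂ (a₀ ε : ℝ) : ℝ :=
  (1 + a₀ ^ 2 + ε ^ 2) / 2 + √((1 + a₀ ^ 2 + ε ^ 2) ^ 2 - 4 * a₀ ^ 2) / 2

end

end AR1

/-!
Write `Q = ∑_{t < N} y_t ^ 2` and `S = ∑_{t < N} y_t e_{t + 1}`. The estimation error is `S / Q`, so
`â_N - a₀ > ε` forces `ε Q ≤ S` (also where `Q = 0`, since then `S = 0`). With `θ = ε / σ ^ 2`,
the indicator of this event is at most
`exp (θ / 2 * (S - ε Q)) = exp (θ S - θ ^ 2 σ ^ 2 Q / 2) ^ (1 / 2) * exp (-θ ε Q / 2) ^ (1 / 2)`,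
and by the Cauchy–Schwarz inequality its probability is at most the square root of the product of
`𝔼 exp (θ S - θ ^ 2 σ ^ 2 Q / 2) = 1` (an exponential martingale, `IsProcess.lintegral_exp_score`)
and `𝔼 exp (-ε ^ 2 Q / (2 σ ^ 2))` (`IsProcess.measure_score_ge`).

The last expectation is `(D (N - 1)) ^ (-1 / 2)`, where `D n` is the determinant of the associated
Gaussian quadratic form. No determinant is computed: the noise is integrated out one variable at
a time, from the newest backwards, and the resulting weights are ratios of the sequences `D` and
`E` of `detSeq` (`IsProcess.lintegral_exp_energy_aux`). The recursion is solved in terms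
of the two roots in `gram_closed_form`, which gives the deviation bound.

For the variance, the same bound holds for the lower tail, and with `u = ε ^ 2` the recursion gives
`D (N - 1) ≥ u (a₀ ^ 2 + u) ^ (N - 2)` (`gramDet_lower`). In the layer-cake formula the probability
is bounded by `1` below the level `c = |a₀| ^ (4 - 2 N / 5) * (N + 5) / N`, and by the integrable
function `2 c ^ (-1 / 4) (a₀ ^ 2 + u) ^ (-(N - 2) / 4)` above it (`lintegral_le_of_tail`); the
outcome is smaller than the stated bound (`variance_bound_arith`).
-/

namespace AR1

open scoped ENNReal

/-! ### Gaussian integrals -/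

lemma lintegral_exp_mul_gaussianReal (v : ℝ≥0) (s : ℝ) :
    ∫⁻ x, ENNReal.ofReal (Real.exp (s * x - s ^ 2 * v / 2)) ∂gaussianReal 0 v = 1 := by
  have hint : Integrable (fun x => Real.exp (s * x - s ^ 2 * v / 2)) (gaussianReal 0 v) := by
    simp_rw [Real.exp_sub]
    exact (integrable_exp_mul_gaussianReal s).div_const _
  have hmgf := mgf_gaussianReal (p := gaussianReal 0 v) (X := id) (μ := 0) (v := v) (by simp) s
  simp only [mgf, id_eq, zero_mul, zero_add] at hmgf
  rw [← ofReal_integral_eq_lintegral_ofReal hint (ae_of_all _ fun x => (Real.exp_pos _).le)]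
  simp_rw [Real.exp_sub]
  rw [integral_div, hmgf, mul_comm (v : ℝ), div_self (Real.exp_pos _).ne', ENNReal.ofReal_one]

/-- Completing the square: the product of a centred Gaussian density and a Gaussian weight is a
multiple of another Gaussian density. -/
lemma lintegral_exp_neg_sq_gaussianReal {v : ℝ≥0} (hv : v ≠ 0) {c : ℝ} (hc : 0 ≤ c) (z : ℝ) :
    ∫⁻ x, ENNReal.ofReal (Real.exp (-(c / (2 * v) * (z + x) ^ 2))) ∂gaussianReal 0 v =
      ENNReal.ofReal (√(1 / (1 + c)) * Real.exp (-(c / (1 + c) / (2 * v) * z ^ 2))) := by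
  have hv' : (0 : ℝ) < v := by positivity
  have hc1 : (0 : ℝ) < 1 + c := by linarith
  set K : ℝ := √(1 / (1 + c)) * Real.exp (-(c / (1 + c) / (2 * v) * z ^ 2)) with hK
  set v' : ℝ≥0 := v / (1 + ⟨c, hc⟩) with hv'def
  have hv'coe : (v' : ℝ) = v / (1 + c) := by simp [hv'def]; rfl
  have hv'0 : v' ≠ 0 := by
    have : (0 : ℝ) < v' := by rw [hv'coe]; positivity
    exact_mod_cast this.ne'
  rw [gaussianReal_of_var_ne_zero _ hv,
    lintegral_withDensity_eq_lintegral_mul _ (measurable_gaussianPDF 0 v) (by fun_prop)]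
  have key : ∀ x, (gaussianPDF 0 v * fun x =>
      ENNReal.ofReal (Real.exp (-(c / (2 * v) * (z + x) ^ 2)))) x =
      ENNReal.ofReal K * gaussianPDF (-(c * z / (1 + c))) v' x := by
    intro x
    simp only [Pi.mul_apply, gaussianPDF]
    rw [← ENNReal.ofReal_mul (gaussianPDFReal_nonneg _ _ _), ← ENNReal.ofReal_mul (by positivity)]
    congr 1
    simp only [gaussianPDFReal, hK, hv'coe]
    have h1 : √(2 * Real.pi * (v / (1 + c))) = √(2 * Real.pi * v) * √(1 / (1 + c)) := by
      rw [← Real.sqrt_mul (by positivity)]; congr 1; ring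
    have hs : √(1 / (1 + c)) ≠ 0 := (Real.sqrt_pos.2 (by positivity)).ne'
    rw [h1, mul_assoc, ← Real.exp_add]
    have h2 : ∀ A B s : ℝ, s ≠ 0 → s * A * ((√(2 * Real.pi * v) * s)⁻¹ * B) =
        (√(2 * Real.pi * v))⁻¹ * (A * B) := by
      intro A B s hs
      rw [mul_inv]
      field_simp
    rw [h2 _ _ _ hs, ← Real.exp_add]
    congr 2
    field_simp
    ring
  rw [lintegral_congr key, lintegral_const_mul _ (measurable_gaussianPDF _ _),
    lintegral_gaussianPDF_eq_one _ hv'0, mul_one]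

/-! ### Integrating out the newest noise variable -/

/-- The σ-algebra generated by `e 1, …, e n`. -/
@[reducible]
def past {Ω : Type*} (e : ℕ → Ω → ℝ) (n : ℕ) : MeasurableSpace Ω :=
  ⨆ i ∈ Set.Iio n, MeasurableSpace.comap (e (i + 1)) inferInstance

/-- The sum of squares `∑_{t < n} y_t ^ 2`. -/
def energy {Ω : Type*} (y : ℕ → Ω → ℝ) (n : ℕ) (ω : Ω) : ℝ :=
  ∑ t ∈ Finset.range n, y t ω ^ 2

/-- The sum `∑_{t < n} y_t e_{t + 1}`, the numerator of the estimation error. -/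
def score {Ω : Type*} (e y : ℕ → Ω → ℝ) (n : ℕ) (ω : Ω) : ℝ :=
  ∑ t ∈ Finset.range n, y t ω * e (t + 1) ω

section Measurability

variable {Ω : Type*} {a₀ : ℝ} {e y : ℕ → Ω → ℝ} {n : ℕ}

lemma measurable_past_noise {i : ℕ} (h : i < n) : Measurable[past e n] (e (i + 1)) :=
  (comap_measurable (e (i + 1))).mono (le_iSup₂_of_le i h le_rfl) le_rfl

variable {m : MeasurableSpace Ω}

lemma measurable_of_noise (h0 : ∀ ω, y 0 ω = 0)
    (hstep : ∀ t ω, y (t + 1) ω = a₀ * y t ω + e (t + 1) ω)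
    (he : ∀ i < n, Measurable (e (i + 1))) {t : ℕ} (ht : t ≤ n) : Measurable (y t) := by
  induction t with
  | zero =>
    rw [show y 0 = fun _ => 0 from funext h0]
    exact measurable_const
  | succ t ih =>
    rw [show y (t + 1) = fun ω => a₀ * y t ω + e (t + 1) ω from funext (hstep t)]
    exact ((ih (by omega)).const_mul a₀).add (he t (by omega))

lemma measurable_energy (hy : ∀ t ≤ n, Measurable (y t)) : Measurable (energy y (n + 1)) :=
  Finset.measurable_fun_sum _ fun t ht =>
    (hy t (Nat.lt_succ_iff.1 (Finset.mem_range.1 ht))).pow_const 2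

lemma measurable_score (hy : ∀ t ≤ n, Measurable (y t)) (he : ∀ i < n, Measurable (e (i + 1))) :
    Measurable (score e y n) :=
  Finset.measurable_fun_sum _ fun t ht =>
    (hy t (Finset.mem_range.1 ht).le).mul (he t (Finset.mem_range.1 ht))

end Measurability

section Independence

variable {Ω : Type*} [MeasurableSpace Ω] {μ : Measure Ω} {a₀ : ℝ} {σ : ℝ≥0} {e y : ℕ → Ω → ℝ}

lemma past_le (hy : IsProcess μ a₀ σ e y) (n : ℕ) : past e n ≤ ‹MeasurableSpace Ω› :=
  iSup₂_le fun i _ => (hy.noise.measurable i).comap_le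

lemma IsProcess.measurable_past (hy : IsProcess μ a₀ σ e y) {t n : ℕ} (h : t ≤ n) :
    Measurable[past e n] (y t) :=
  measurable_of_noise hy.init hy.step (fun _ hi => measurable_past_noise hi) h

lemma IsProcess.measurable (hy : IsProcess μ a₀ σ e y) (t : ℕ) : Measurable (y t) :=
  (hy.measurable_past le_rfl).mono (past_le hy t) le_rfl

/-- Fubini for the independent pair formed by the past up to time `n` and `e (n + 1)`. -/
lemma IsProcess.lintegral_past [IsProbabilityMeasure μ] (hy : IsProcess μ a₀ σ e y) {n : ℕ}
    {E : Type*} [MeasurableSpace E] {H : Ω → E} (hH : Measurable[past e n] H)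
    {f : E × ℝ → ℝ≥0∞} (hf : Measurable f) :
    ∫⁻ ω, f (H ω, e (n + 1) ω) ∂μ =
      ∫⁻ ω, ∫⁻ x, f (H ω, x) ∂gaussianReal 0 (σ ^ 2) ∂μ := by
  have hHm : Measurable H := hH.mono (past_le hy n) le_rfl
  have hem : Measurable (e (n + 1)) := hy.noise.measurable n
  have hind : IndepFun H (e (n + 1)) μ := by
    have h1 := indep_iSup_of_disjoint (fun i => (hy.noise.measurable i).comap_le)
      hy.noise.indep.iIndep (S := Set.Iio n) (T := {n}) (by simp)
    simp only [Set.mem_singleton_iff, iSup_iSup_eq_left] at h1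
    rw [IndepFun_iff_Indep]
    exact indep_of_indep_of_le_left h1 hH.comap_le
  have hmap := hind.map_prod_eq_prod_map_map hHm.aemeasurable hem.aemeasurable
  rw [(hy.noise.law n).map_eq] at hmap
  rw [← lintegral_map hf (hHm.prodMk hem), hmap, lintegral_prod _ hf.aemeasurable,
    lintegral_map hf.lintegral_prod_right' hHm]

end Independence

/-! ### The determinant recursion -/

/-- The pair `(D n, E n)` with `D 0 = 1`, `E 0 = 0`, `E (n + 1) = a ^ 2 * E n + u * D n` and
`D (n + 1) = D n + E (n + 1)`. Here `D n` is the determinant of `Aᵀ A + u I` for the `n × n`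
bidiagonal matrix `A` with `1` on the diagonal and `-a` below it, and `E` is its increment. -/
def detSeq (a u : ℝ) : ℕ → ℝ × ℝ
  | 0 => (1, 0)
  | n + 1 => ((detSeq a u n).1 + (a ^ 2 * (detSeq a u n).2 + u * (detSeq a u n).1),
      a ^ 2 * (detSeq a u n).2 + u * (detSeq a u n).1)

/-- The determinant `D n` of `detSeq`. -/
def gramDet (a u : ℝ) (n : ℕ) : ℝ := (detSeq a u n).1

/-- The increment `E n = D n - D (n - 1)` of `detSeq`. -/
def gramInc (a u : ℝ) (n : ℕ) : ℝ := (detSeq a u n).2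

variable {a u : ℝ}

@[simp] lemma gramDet_zero : gramDet a u 0 = 1 := rfl

@[simp] lemma gramInc_zero : gramInc a u 0 = 0 := rfl

lemma gramInc_succ (n : ℕ) : gramInc a u (n + 1) = a ^ 2 * gramInc a u n + u * gramDet a u n := rfl

lemma gramDet_succ (n : ℕ) : gramDet a u (n + 1) = gramDet a u n + gramInc a u (n + 1) := rfl

lemma gram_bounds (hu : 0 ≤ u) (n : ℕ) : 1 ≤ gramDet a u n ∧ 0 ≤ gramInc a u n := by
  induction n with
  | zero => simp
  | succ n ih =>
    have h : 0 ≤ gramInc a u (n + 1) := by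
      rw [gramInc_succ]
      have := mul_nonneg hu (zero_le_one.trans ih.1)
      have := mul_nonneg (sq_nonneg a) ih.2
      linarith
    exact ⟨by rw [gramDet_succ]; linarith [ih.1], h⟩

lemma gramDet_pos (hu : 0 ≤ u) (n : ℕ) : 0 < gramDet a u n :=
  zero_lt_one.trans_le (gram_bounds hu n).1

lemma gramInc_nonneg (hu : 0 ≤ u) (n : ℕ) : 0 ≤ gramInc a u n := (gram_bounds hu n).2

lemma gramInc_lower (hu : 0 ≤ u) (n : ℕ) : u * (a ^ 2 + u) ^ n ≤ gramInc a u (n + 1) := by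
  induction n with
  | zero => simp [gramInc_succ]
  | succ n ih =>
    have hD : gramInc a u (n + 1) ≤ gramDet a u (n + 1) := by
      rw [gramDet_succ]; linarith [gramDet_pos (a := a) hu n]
    calc u * (a ^ 2 + u) ^ (n + 1) = (a ^ 2 + u) * (u * (a ^ 2 + u) ^ n) := by ring
      _ ≤ (a ^ 2 + u) * gramInc a u (n + 1) := by gcongr
      _ = a ^ 2 * gramInc a u (n + 1) + u * gramInc a u (n + 1) := by ring
      _ ≤ _ := by rw [gramInc_succ (n + 1)]; gcongr

lemma gramDet_lower (hu : 0 ≤ u) (n : ℕ) : u * (a ^ 2 + u) ^ n ≤ gramDet a u (n + 1) := by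
  rw [gramDet_succ]
  linarith [gramInc_lower (a := a) hu n, gramDet_pos (a := a) hu n]

lemma gram_closed_form {l₁ l₂ : ℝ} (hadd : l₁ + l₂ = 1 + a ^ 2 + u) (hmul : l₁ * l₂ = a ^ 2)
    (n : ℕ) :
    (l₂ - l₁) * gramDet a u n = (l₂ - 1) * l₁ ^ (n + 1) - (l₁ - 1) * l₂ ^ (n + 1) ∧
      (l₂ - l₁) * gramInc a u n = u * (l₂ ^ n - l₁ ^ n) := by
  have hu : u = -((l₁ - 1) * (l₂ - 1)) := by linear_combination hmul - hadd
  induction n with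
  | zero => simp; ring
  | succ n ih =>
    have h : (l₂ - l₁) * gramInc a u (n + 1) = u * (l₂ ^ (n + 1) - l₁ ^ (n + 1)) := by
      rw [gramInc_succ]
      linear_combination a ^ 2 * ih.2 + u * ih.1 - u * (l₂ ^ n - l₁ ^ n) * hmul
    refine ⟨?_, h⟩
    rw [gramDet_succ, mul_add, ih.1, h, hu]
    ring

/-- The right-hand side of the deviation bound, before taking the fourth root. -/
lemma roots_quotient (ha : 0 < a ^ 2) {ε : ℝ} (hε : 0 < ε) (n : ℕ) :
    (root₂ a ε - root₁ a ε) / ((root₂ a ε - 1) * root₁ a ε ^ (n + 1) -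
      (root₁ a ε - 1) * root₂ a ε ^ (n + 1)) = 1 / gramDet a (ε ^ 2) n := by
  have hε2 : 0 < ε ^ 2 := by positivity
  have hdisc : 0 < (1 + a ^ 2 + ε ^ 2) ^ 2 - 4 * a ^ 2 := by
    nlinarith [sq_nonneg (a ^ 2 - 1), mul_pos hε2 ha, sq_nonneg (ε ^ 2)]
  have hs := Real.sq_sqrt hdisc.le
  have hsub : 0 < root₂ a ε - root₁ a ε := by
    have := Real.sqrt_pos.2 hdisc
    simp only [root₁, root₂]
    linarith
  have hadd : root₁ a ε + root₂ a ε = 1 + a ^ 2 + ε ^ 2 := by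
    simp only [root₁, root₂]; ring
  have hmul : root₁ a ε * root₂ a ε = a ^ 2 := by
    simp only [root₁, root₂]
    linear_combination -(1 / 4) * hs
  rw [← (gram_closed_form hadd hmul n).1]
  have := gramDet_pos (a := a) hε2.le n
  field_simp

/-! ### Exponential moments of the process -/

section Moments

variable {Ω : Type*} [MeasurableSpace Ω] {μ : Measure Ω} [IsProbabilityMeasure μ] {a₀ : ℝ}
  {σ : ℝ≥0} {e y : ℕ → Ω → ℝ}

/-- The exponential martingale of the process has mean `1`. -/
lemma IsProcess.lintegral_exp_score (hy : IsProcess μ a₀ σ e y) (θ : ℝ) (n : ℕ) :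
    ∫⁻ ω, ENNReal.ofReal (Real.exp (θ * score e y n ω -
      θ ^ 2 * (σ ^ 2 : ℝ≥0) / 2 * energy y n ω)) ∂μ = 1 := by
  induction n with
  | zero => simp [score, energy]
  | succ n ih =>
    rw [← ih]
    have hmy : ∀ t ≤ n, Measurable[past e n] (y t) := fun t ht => hy.measurable_past ht
    let H : Ω → (ℝ × ℝ) × ℝ := fun ω => ((score e y n ω, energy y (n + 1) ω), y n ω)
    have hH : Measurable[past e n] H :=
      ((measurable_score hmy fun i hi => measurable_past_noise hi).prodMk
        (measurable_energy hmy)).prodMk (hmy n le_rfl)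
    have key := hy.lintegral_past hH (f := fun p => ENNReal.ofReal (Real.exp
      (θ * (p.1.1.1 + p.1.2 * p.2) - θ ^ 2 * (σ ^ 2 : ℝ≥0) / 2 * p.1.1.2))) (by fun_prop)
    have hsc : ∀ ω, score e y (n + 1) ω = score e y n ω + y n ω * e (n + 1) ω :=
      fun ω => Finset.sum_range_succ _ _
    simp_rw [hsc]
    refine key.trans (lintegral_congr fun ω => ?_)
    have hen : energy y (n + 1) ω = energy y n ω + y n ω ^ 2 := Finset.sum_range_succ _ _
    have hfac : ∀ x : ℝ, ENNReal.ofReal (Real.exp (θ * (score e y n ω + y n ω * x) -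
        θ ^ 2 * (σ ^ 2 : ℝ≥0) / 2 * energy y (n + 1) ω)) =
        ENNReal.ofReal (Real.exp (θ * score e y n ω -
          θ ^ 2 * (σ ^ 2 : ℝ≥0) / 2 * energy y n ω)) *
        ENNReal.ofReal (Real.exp (θ * y n ω * x - (θ * y n ω) ^ 2 * (σ ^ 2 : ℝ≥0) / 2)) := by
      intro x
      rw [← ENNReal.ofReal_mul (Real.exp_pos _).le, ← Real.exp_add, hen]
      congr 2
      ring
    simp only [H]
    rw [lintegral_congr hfac, lintegral_const_mul _ (by fun_prop),
      lintegral_exp_mul_gaussianReal, mul_one]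

/-- Integrating out the noise backwards in time turns the weight
`a₀ ^ 2 * gramInc j / gramDet j` on the last observation into the same expression at `j + 1`,
and the normalising factors telescope. -/
lemma IsProcess.lintegral_exp_energy_aux (hy : IsProcess μ a₀ σ e y) (hσ : 0 < σ) {u : ℝ}
    (hu : 0 ≤ u) (m j : ℕ) :
    ∫⁻ ω, ENNReal.ofReal (Real.exp (-(u / (2 * (σ ^ 2 : ℝ≥0)) * energy y (m + 1) ω) -
      a₀ ^ 2 * (gramInc a₀ u j / gramDet a₀ u j) / (2 * (σ ^ 2 : ℝ≥0)) * y m ω ^ 2)) ∂μ =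
      ENNReal.ofReal (√(gramDet a₀ u j / gramDet a₀ u (j + m))) := by
  have hD := gramDet_pos (a := a₀) hu
  induction m generalizing j with
  | zero => simp [energy, hy.init, div_self (hD j).ne']
  | succ m ih =>
    have hv : σ ^ 2 ≠ 0 := (pow_pos hσ 2).ne'
    have hv' : (0 : ℝ) < (σ ^ 2 : ℝ≥0) := by exact_mod_cast pow_pos hσ 2
    set v : ℝ≥0 := σ ^ 2 with hvdef
    set c : ℝ := gramInc a₀ u (j + 1) / gramDet a₀ u j with hc
    have hc0 : 0 ≤ c := div_nonneg (gramInc_nonneg hu _) (hD _).le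
    have hc1 : 1 + c = gramDet a₀ u (j + 1) / gramDet a₀ u j := by
      rw [hc, gramDet_succ]; have := (hD j).ne'; field_simp
    have hc2 : c / (1 + c) = gramInc a₀ u (j + 1) / gramDet a₀ u (j + 1) := by
      rw [hc1, hc]; have := (hD j).ne'; have := (hD (j + 1)).ne'; field_simp
    have hc3 : u + a₀ ^ 2 * (gramInc a₀ u j / gramDet a₀ u j) = c := by
      rw [hc, gramInc_succ]; have := (hD j).ne'; field_simp; ring
    have hmy : ∀ t ≤ m, Measurable[past e m] (y t) := fun t ht => hy.measurable_past ht
    let H : Ω → ℝ × ℝ := fun ω => (energy y (m + 1) ω, y m ω)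
    have hH : Measurable[past e m] H := (measurable_energy hmy).prodMk (hmy m le_rfl)
    have key := hy.lintegral_past hH (f := fun p => ENNReal.ofReal
      (Real.exp (-(u / (2 * v) * p.1.1) - c / (2 * v) * (a₀ * p.1.2 + p.2) ^ 2))) (by fun_prop)
    have hpt : ∀ ω, -(u / (2 * v) * energy y (m + 1 + 1) ω) -
        a₀ ^ 2 * (gramInc a₀ u j / gramDet a₀ u j) / (2 * v) * y (m + 1) ω ^ 2 =
        -(u / (2 * v) * energy y (m + 1) ω) - c / (2 * v) * (a₀ * y m ω + e (m + 1) ω) ^ 2 := by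
      intro ω
      rw [show energy y (m + 1 + 1) ω = energy y (m + 1) ω + y (m + 1) ω ^ 2 from
        Finset.sum_range_succ _ _, ← hc3, ← hy.step]
      ring
    simp_rw [hpt]
    refine key.trans ?_
    have hin : ∀ ω, ∫⁻ x, ENNReal.ofReal (Real.exp (-(u / (2 * v) * energy y (m + 1) ω) -
        c / (2 * v) * (a₀ * y m ω + x) ^ 2)) ∂gaussianReal 0 v =
        ENNReal.ofReal (√(1 / (1 + c))) *
        ENNReal.ofReal (Real.exp (-(u / (2 * v) * energy y (m + 1) ω) -
          a₀ ^ 2 * (gramInc a₀ u (j + 1) / gramDet a₀ u (j + 1)) / (2 * v) * y m ω ^ 2)) := by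
      intro ω
      simp_rw [sub_eq_add_neg, Real.exp_add, ENNReal.ofReal_mul (Real.exp_pos _).le]
      rw [lintegral_const_mul _ (by fun_prop), lintegral_exp_neg_sq_gaussianReal hv hc0,
        ← hc2, ENNReal.ofReal_mul (Real.sqrt_nonneg _), mul_left_comm]
      congr 5
      ring
    simp only [H]
    have hym := hy.measurable
    have hen : Measurable (energy y (m + 1)) := measurable_energy fun t _ => hym t
    rw [lintegral_congr hin, lintegral_const_mul _ (by fun_prop), ih (j + 1),
      ← ENNReal.ofReal_mul (Real.sqrt_nonneg _), ← Real.sqrt_mul (by positivity), hc1]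
    congr 2
    have := (hD j).ne'
    have := (hD (j + 1)).ne'
    rw [show j + 1 + m = j + (m + 1) by ring]
    field_simp

lemma IsProcess.lintegral_exp_energy (hy : IsProcess μ a₀ σ e y) (hσ : 0 < σ) {u : ℝ}
    (hu : 0 ≤ u) (m : ℕ) :
    ∫⁻ ω, ENNReal.ofReal (Real.exp (-(u / (2 * (σ ^ 2 : ℝ≥0)) * energy y (m + 1) ω))) ∂μ =
      ENNReal.ofReal (√(1 / gramDet a₀ u m)) := by
  simpa using hy.lintegral_exp_energy_aux hσ hu m 0

end Moments

/-! ### Deviation bounds -/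

section Deviation

variable {Ω : Type*} [MeasurableSpace Ω] {μ : Measure Ω} {a₀ : ℝ} {σ : ℝ≥0} {e y : ℕ → Ω → ℝ}

lemma ofReal_exp_rpow_two (x : ℝ) :
    ENNReal.ofReal (Real.exp x) ^ (2 : ℝ) = ENNReal.ofReal (Real.exp (2 * x)) := by
  rw [ENNReal.ofReal_rpow_of_pos (Real.exp_pos _), ← Real.exp_mul, mul_comm]

/-- Chernoff's bound with exponent `ε / (2 σ ^ 2)`, the Cauchy–Schwarz inequality separating the
exponential martingale from the energy. The sign `s` covers both tails. -/
lemma IsProcess.measure_score_ge [IsProbabilityMeasure μ] (hy : IsProcess μ a₀ σ e y)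
    (hσ : 0 < σ) {ε s : ℝ} (hε : 0 < ε) (hs : s ^ 2 = 1) (n : ℕ) :
    μ {ω | ε * energy y (n + 1) ω ≤ s * score e y (n + 1) ω} ≤
      ENNReal.ofReal ((1 / gramDet a₀ (ε ^ 2) n) ^ (1 / 4 : ℝ)) := by
  have hv' : (0 : ℝ) < (σ ^ 2 : ℝ≥0) := by exact_mod_cast pow_pos hσ 2
  have hmart := hy.lintegral_exp_score (2 * (ε / (2 * (σ ^ 2 : ℝ≥0))) * s) (n + 1)
  have hen := hy.lintegral_exp_energy hσ (sq_nonneg ε) n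
  set v : ℝ≥0 := σ ^ 2 with hvdef
  set l : ℝ := ε / (2 * v) with hl
  have hl0 : 0 < l := by positivity
  have hlv : l * v = ε / 2 := by rw [hl]; field_simp
  have hQm : Measurable (energy y (n + 1)) := measurable_energy fun t _ => hy.measurable t
  have hSm : Measurable (score e y (n + 1)) :=
    measurable_score (fun t _ => hy.measurable t) fun i _ => hy.noise.measurable i
  let f : Ω → ℝ≥0∞ := fun ω => ENNReal.ofReal (Real.exp
    (l * s * score e y (n + 1) ω - l * ε / 2 * energy y (n + 1) ω))
  let g : Ω → ℝ≥0∞ := fun ω => ENNReal.ofReal (Real.exp (-(l * ε / 2 * energy y (n + 1) ω)))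
  have hf : Measurable f := by fun_prop
  have hg : Measurable g := by fun_prop
  have hf2 : ∫⁻ ω, f ω ^ (2 : ℝ) ∂μ = 1 := by
    rw [← hmart]
    refine lintegral_congr fun ω => ?_
    simp only [f]
    rw [ofReal_exp_rpow_two]
    congr 2
    linear_combination -(energy y (n + 1) ω) * (-2 * l * hlv - 2 * l ^ 2 * v * hs)
  have hg2 : ∫⁻ ω, g ω ^ (2 : ℝ) ∂μ = ENNReal.ofReal (√(1 / gramDet a₀ (ε ^ 2) n)) := by
    rw [← hen]
    refine lintegral_congr fun ω => ?_
    simp only [g]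
    rw [ofReal_exp_rpow_two, hl]
    congr 2
    ring
  have hCS := ENNReal.lintegral_mul_le_Lp_mul_Lq μ Real.HolderConjugate.two_two
    hf.aemeasurable hg.aemeasurable
  rw [hf2, hg2, ENNReal.one_rpow, one_mul, ENNReal.ofReal_rpow_of_nonneg (Real.sqrt_nonneg _)
    (by norm_num), Real.sqrt_eq_rpow, ← Real.rpow_mul
    (one_div_nonneg.2 (gramDet_pos (sq_nonneg ε) n).le)] at hCS
  norm_num at hCS ⊢
  refine (meas_le_lintegral₀ (f := f * g) (hf.mul hg).aemeasurable fun ω hω => ?_).trans hCS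
  simp only [Pi.mul_apply, f, g]
  rw [← ENNReal.ofReal_mul (Real.exp_pos _).le, ← Real.exp_add, ENNReal.one_le_ofReal,
    Real.one_le_exp_iff]
  have := mul_nonneg hl0.le (sub_nonneg.2 hω.out)
  linarith

lemma IsProcess.lsEstimate_eq (hy : IsProcess μ a₀ σ e y) (n : ℕ) (ω : Ω) :
    lsEstimate y (n + 1) ω =
      (a₀ * energy y (n + 1) ω + score e y (n + 1) ω) / energy y (n + 1) ω := by
  have hden : ∑ t ∈ Finset.Icc 1 n, y t ω ^ 2 = energy y (n + 1) ω := by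
    induction n with
    | zero => simp [energy, hy.init]
    | succ n ih =>
      rw [Finset.sum_Icc_succ_top (by omega), ih, energy, energy, Finset.sum_range_succ _ (n + 1)]
  have hnum : ∑ t ∈ Finset.Icc 2 (n + 1), y t ω * y (t - 1) ω =
      a₀ * energy y (n + 1) ω + score e y (n + 1) ω := by
    clear hden
    induction n with
    | zero => simp [energy, score, hy.init]
    | succ n ih =>
      rw [Finset.sum_Icc_succ_top (by omega), ih, energy, energy, score, score,
        Finset.sum_range_succ _ (n + 1), Finset.sum_range_succ _ (n + 1), hy.step (n + 1)]
      simp only [Nat.add_sub_cancel]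
      ring
  rw [lsEstimate, Nat.add_sub_cancel, hden, hnum]

/-- Where the energy vanishes all observations vanish, and so does the score; elsewhere the
energy is positive and the estimation error is their quotient. -/
lemma IsProcess.error_dichotomy (hy : IsProcess μ a₀ σ e y) (n : ℕ) (ω : Ω) :
    (energy y (n + 1) ω = 0 ∧ score e y (n + 1) ω = 0) ∨
      (0 < energy y (n + 1) ω ∧
        (lsEstimate y (n + 1) ω - a₀) * energy y (n + 1) ω = score e y (n + 1) ω) := by
  have h0 : 0 ≤ energy y (n + 1) ω := Finset.sum_nonneg fun t _ => sq_nonneg _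
  rcases h0.eq_or_lt with h | h
  · refine Or.inl ⟨h.symm, Finset.sum_eq_zero fun t ht => ?_⟩
    have := (Finset.sum_eq_zero_iff_of_nonneg fun t _ => sq_nonneg (y t ω)).1 h.symm t ht
    rw [pow_eq_zero_iff two_ne_zero] at this
    rw [this, zero_mul]
  · refine Or.inr ⟨h, ?_⟩
    rw [hy.lsEstimate_eq]
    field_simp
    ring

lemma IsProcess.measure_error_gt [IsProbabilityMeasure μ] (hy : IsProcess μ a₀ σ e y)
    (hσ : 0 < σ) {ε : ℝ} (hε : 0 < ε) (n : ℕ) :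
    μ {ω | lsEstimate y (n + 1) ω - a₀ > ε} ≤
      ENNReal.ofReal ((1 / gramDet a₀ (ε ^ 2) n) ^ (1 / 4 : ℝ)) := by
  refine (measure_mono fun ω hω => ?_).trans (hy.measure_score_ge hσ hε (one_pow 2) n)
  have hω' : ε < lsEstimate y (n + 1) ω - a₀ := hω
  rw [Set.mem_ofPred_eq]
  rcases hy.error_dichotomy n ω with ⟨h1, h2⟩ | ⟨h1, h2⟩
  · simp [h1, h2]
  · rw [one_mul, ← h2]
    gcongr

lemma IsProcess.measure_error_sq_gt [IsProbabilityMeasure μ] (hy : IsProcess μ a₀ σ e y)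
    (hσ : 0 < σ) {u : ℝ} (hu : 0 < u) (n : ℕ) :
    μ {ω | u < (lsEstimate y (n + 1) ω - a₀) ^ 2} ≤
      ENNReal.ofReal (2 * (1 / gramDet a₀ u n) ^ (1 / 4 : ℝ)) := by
  have hε : 0 < √u := Real.sqrt_pos.2 hu
  have h1 := hy.measure_score_ge hσ hε (one_pow 2) n
  have h2 := hy.measure_score_ge hσ hε (s := -1) (by norm_num) n
  rw [Real.sq_sqrt hu.le] at h1 h2
  rw [two_mul, ENNReal.ofReal_add (by have := gramDet_pos (a := a₀) hu.le n; positivity)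
    (by have := gramDet_pos (a := a₀) hu.le n; positivity)]
  refine (measure_mono fun ω hω => ?_).trans ((measure_union_le _ _).trans (add_le_add h1 h2))
  have hω' : √u < |lsEstimate y (n + 1) ω - a₀| := by
    rw [← Real.sqrt_sq_eq_abs]; exact Real.sqrt_lt_sqrt hu.le hω
  rcases hy.error_dichotomy n ω with ⟨h1, h2⟩ | ⟨h1, h2⟩
  · left; simp [h1, h2]
  · rcases lt_abs.1 hω' with h | h
    · left; rw [Set.mem_ofPred_eq, one_mul, ← h2]; gcongr
    · right; rw [Set.mem_ofPred_eq, neg_one_mul, ← h2, ← neg_mul]; gcongr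

end Deviation

/-! ### From tails to the variance -/

lemma integral_Ioi_add_rpow {b c p : ℝ} (hp : p < -1) (hbc : 0 < c + b) :
    ∫ t in Set.Ioi c, (t + b) ^ p = -(c + b) ^ (p + 1) / (p + 1) := by
  have hp1 : p + 1 ≠ 0 := by linarith
  have hd : ∀ x ∈ Set.Ici c, HasDerivAt (fun t => (t + b) ^ (p + 1) / (p + 1)) ((x + b) ^ p) x := by
    intro x hx
    have hx' : x + b ≠ 0 := by have := Set.mem_Ici.1 hx; linarith
    have h := ((Real.hasDerivAt_rpow_const (p := p + 1) (Or.inl hx')).comp_add_const x b).div_const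
      (p + 1)
    rwa [add_sub_cancel_right, mul_div_cancel_left₀ _ hp1] at h
  have ht : Filter.Tendsto (fun t : ℝ => (t + b) ^ (p + 1) / (p + 1)) Filter.atTop
      (nhds (0 / (p + 1))) := by
    have := (tendsto_rpow_neg_atTop (y := -(p + 1)) (by linarith)).comp
      (Filter.tendsto_atTop_add_const_right Filter.atTop b Filter.tendsto_id)
    rw [neg_neg] at this
    exact this.div_const _
  rw [integral_Ioi_of_hasDerivAt_of_tendsto' hd
    (integrableOn_add_rpow_Ioi_of_lt hp (by linarith)) ht]
  ring

/-- The layer-cake formula, with the tail bounded by `1` up to the level `c`. -/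
lemma lintegral_le_of_tail {Ω : Type*} [MeasurableSpace Ω] {μ : Measure Ω} [IsProbabilityMeasure μ]
    {f : Ω → ℝ} (hf : Measurable f) (hf0 : ∀ ω, 0 ≤ f ω) {b c : ℝ} (hb : 0 < b) (hc : 0 < c)
    {k : ℕ} (hk : 5 ≤ k)
    (htail : ∀ u, 0 < u → μ {ω | u < f ω} ≤
      ENNReal.ofReal (2 * (1 / (u * (b + u) ^ k)) ^ (1 / 4 : ℝ))) :
    ∫⁻ ω, ENNReal.ofReal (f ω) ∂μ ≤
      ENNReal.ofReal (c + 8 / ((k : ℝ) - 4) * c ^ (-(1 / 4) : ℝ) * b ^ (1 - (k : ℝ) / 4)) := by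
  have hk' : (5 : ℝ) ≤ k := by exact_mod_cast hk
  have hp : -((k : ℝ) / 4) < -1 := by linarith
  rw [lintegral_eq_lintegral_meas_lt μ (ae_of_all _ hf0) hf.aemeasurable,
    ← Set.Ioc_union_Ioi_eq_Ioi hc.le, ENNReal.ofReal_add hc.le
      (by have : (0 : ℝ) < k - 4 := by linarith
          positivity)]
  refine (lintegral_union_le _ _ _).trans (add_le_add ?_ ?_)
  · calc ∫⁻ t in Set.Ioc 0 c, μ {ω | t < f ω} ≤ ∫⁻ _ in Set.Ioc 0 c, 1 :=
        lintegral_mono fun t => prob_le_one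
      _ = ENNReal.ofReal c := by simp
  · calc ∫⁻ t in Set.Ioi c, μ {ω | t < f ω}
        ≤ ∫⁻ t in Set.Ioi c,
          ENNReal.ofReal (2 * c ^ (-(1 / 4) : ℝ) * (t + b) ^ (-((k : ℝ) / 4))) := by
          refine setLIntegral_mono' measurableSet_Ioi fun t ht => ?_
          have htc : c < t := ht
          have ht0 : 0 < t := hc.trans htc
          refine (htail t ht0).trans (ENNReal.ofReal_le_ofReal ?_)
          rw [one_div, Real.inv_rpow (by positivity), ← Real.rpow_neg (by positivity),
            Real.mul_rpow ht0.le (by positivity), ← Real.rpow_natCast, ← Real.rpow_mul (by positivity),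
            add_comm b t, mul_assoc, show (k : ℝ) * -(1 / 4) = -((k : ℝ) / 4) by ring]
          gcongr 2 * (?_ * _)
          exact Real.rpow_le_rpow_of_nonpos hc htc.le (by norm_num)
      _ = ENNReal.ofReal (2 * c ^ (-(1 / 4) : ℝ) *
          (-(c + b) ^ (-((k : ℝ) / 4) + 1) / (-((k : ℝ) / 4) + 1))) := by
          rw [← integral_Ioi_add_rpow hp (by positivity), ← integral_const_mul,
            ofReal_integral_eq_lintegral_ofReal
              ((integrableOn_add_rpow_Ioi_of_lt hp (by linarith)).const_mul _)]
          refine (ae_restrict_iff' measurableSet_Ioi).2 (ae_of_all _ fun t ht => ?_)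
          have htc : c < t := ht
          have : 0 < t + b := by linarith
          change 0 ≤ _
          positivity
      _ ≤ _ := by
          refine ENNReal.ofReal_le_ofReal ?_
          have hmono : (c + b) ^ (1 - (k : ℝ) / 4) ≤ b ^ (1 - (k : ℝ) / 4) :=
            Real.rpow_le_rpow_of_nonpos hb (by linarith) (by linarith)
          have hk4 : (0 : ℝ) < k - 4 := by linarith
          have heq : -(c + b) ^ (-((k : ℝ) / 4) + 1) / (-((k : ℝ) / 4) + 1) =
              4 / ((k : ℝ) - 4) * (c + b) ^ (1 - (k : ℝ) / 4) := by
            rw [show -((k : ℝ) / 4) + 1 = 1 - (k : ℝ) / 4 by ring]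
            have : 1 - (k : ℝ) / 4 ≠ 0 := by linarith
            rw [div_mul_eq_mul_div, div_eq_div_iff this hk4.ne']
            ring
          rw [heq]
          calc _ = 8 / ((k : ℝ) - 4) * c ^ (-(1 / 4) : ℝ) * (c + b) ^ (1 - (k : ℝ) / 4) := by ring
            _ ≤ _ := by gcongr

/-- Splitting the tail integral at `b ^ (2 - N / 5) * (N + 5) / N` gives the stated bound; the
discarded half of the first summand pays for the term `-1 / (N + 2)`. -/
lemma variance_bound_arith {b N : ℝ} (hb : 1 < b) (hN : 7 ≤ N) :
    b ^ (2 - N / 5) * ((N + 5) / N) + 8 / (N - 2 - 4) *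
      (b ^ (2 - N / 5) * ((N + 5) / N)) ^ (-(1 / 4) : ℝ) * b ^ (1 - (N - 2) / 4) ≤
    b ^ (-(N / 5)) * (2 * b ^ 2 * (N + 5) / N + 8 * (N / (N + 5)) ^ (1 / 4 : ℝ) *
      (b / (N - 6) - 1 / (N + 2))) := by
  have hb0 : 0 < b := by linarith
  have hN0 : 0 < N := by linarith
  have hN6 : 0 < N - 6 := by linarith
  have h1 : b ^ (2 - N / 5) = b ^ (-(N / 5)) * b ^ 2 := by
    rw [← Real.rpow_natCast, ← Real.rpow_add hb0]; congr 1; push_cast; ring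
  have h2 : (b ^ (2 - N / 5) * ((N + 5) / N)) ^ (-(1 / 4) : ℝ) * b ^ (1 - (N - 2) / 4) =
      b ^ (-(N / 5)) * b * (N / (N + 5)) ^ (1 / 4 : ℝ) := by
    rw [Real.mul_rpow (by positivity) (by positivity), ← Real.rpow_mul hb0.le, mul_right_comm,
      ← Real.rpow_add hb0, Real.rpow_neg (by positivity), ← Real.inv_rpow (by positivity), inv_div]
    congr 1
    rw [← Real.rpow_add_one hb0.ne']
    congr 1
    ring
  have hq : (N / (N + 5)) ^ (1 / 4 : ℝ) ≤ 1 :=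
    Real.rpow_le_one (by positivity) ((div_le_one (by positivity)).2 (by linarith)) (by norm_num)
  have h3 : 8 * (N / (N + 5)) ^ (1 / 4 : ℝ) * (1 / (N + 2)) ≤ b ^ 2 * ((N + 5) / N) := by
    calc 8 * (N / (N + 5)) ^ (1 / 4 : ℝ) * (1 / (N + 2)) ≤ 8 * 1 * (1 / (N + 2)) := by gcongr
      _ = 8 / (N + 2) := by ring
      _ ≤ 1 := (div_le_one (by positivity)).2 (by linarith)
      _ ≤ b ^ 2 * ((N + 5) / N) := one_le_mul_of_one_le_of_one_le (one_le_pow₀ hb.le)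
          ((one_le_div hN0).2 (by linarith))
  rw [mul_assoc (8 / _), h2, h1, sub_sub, show (2 : ℝ) + 4 = 6 by norm_num]
  have h4 := mul_le_mul_of_nonneg_left h3 (Real.rpow_nonneg hb0.le (-(N / 5)))
  calc _ = b ^ (-(N / 5)) * (b ^ 2 * ((N + 5) / N) +
        8 * (N / (N + 5)) ^ (1 / 4 : ℝ) * (b / (N - 6))) := by ring
    _ ≤ _ := by
      have : 2 * b ^ 2 * (N + 5) / N = b ^ 2 * ((N + 5) / N) + b ^ 2 * ((N + 5) / N) := by ring
      rw [this]
      linarith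

lemma IsProcess.variance_bound {Ω : Type*} [MeasurableSpace Ω] {μ : Measure Ω}
    [IsProbabilityMeasure μ] {a₀ : ℝ} (ha₀ : 1 < |a₀|) {σ : ℝ≥0} (hσ : 0 < σ)
    {e y : ℕ → Ω → ℝ} (hy : IsProcess μ a₀ σ e y) {N : ℕ} (hN : 7 ≤ N) :
    Integrable (fun ω => (lsEstimate y N ω - a₀) ^ 2) μ ∧
      lsVariance μ a₀ y N ≤
        |a₀| ^ (-(2 * (N : ℝ) / 5)) *
          (2 * a₀ ^ 4 * ((N : ℝ) + 5) / N +
            8 * ((N : ℝ) / ((N : ℝ) + 5)) ^ (1 / 4 : ℝ) *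
              (a₀ ^ 2 / ((N : ℝ) - 6) - 1 / ((N : ℝ) + 2))) := by
  obtain ⟨k, rfl⟩ : ∃ k, N = k + 1 + 1 := ⟨N - 2, by omega⟩
  have hb : 1 < a₀ ^ 2 := (one_lt_sq_iff_one_lt_abs _).2 ha₀
  have hb0 : 0 < a₀ ^ 2 := by linarith
  have hNr : (7 : ℝ) ≤ ((k + 1 + 1 : ℕ) : ℝ) := by exact_mod_cast hN
  have hm : Measurable fun ω => (lsEstimate y (k + 1 + 1) ω - a₀) ^ 2 := by
    have := hy.measurable
    unfold lsEstimate
    fun_prop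
  have hc : 0 < (a₀ ^ 2) ^ (2 - ((k + 1 + 1 : ℕ) : ℝ) / 5) *
      ((((k + 1 + 1 : ℕ) : ℝ) + 5) / ((k + 1 + 1 : ℕ) : ℝ)) := by positivity
  have hlin := lintegral_le_of_tail hm (fun ω => sq_nonneg _) hb0 hc (k := k) (by omega)
    (fun u hu => (hy.measure_error_sq_gt hσ hu (k + 1)).trans (ENNReal.ofReal_le_ofReal (by
      have := gramDet_lower (a := a₀) hu.le k
      have := gramDet_pos (a := a₀) hu.le (k + 1)
      gcongr)))
  have hle := variance_bound_arith hb hNr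
  have hk : (k : ℝ) = ((k + 1 + 1 : ℕ) : ℝ) - 2 := by push_cast; ring
  rw [hk] at hlin
  have hrhs : |a₀| ^ (-(2 * ((k + 1 + 1 : ℕ) : ℝ) / 5)) =
      (a₀ ^ 2) ^ (-(((k + 1 + 1 : ℕ) : ℝ) / 5)) := by
    rw [← sq_abs, ← Real.rpow_natCast, ← Real.rpow_mul (abs_nonneg _)]
    congr 1; push_cast; ring
  rw [hrhs, show a₀ ^ 4 = (a₀ ^ 2) ^ 2 by ring]
  have hint : Integrable (fun ω => (lsEstimate y (k + 1 + 1) ω - a₀) ^ 2) μ := by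
    refine ⟨hm.aestronglyMeasurable, ?_⟩
    rw [hasFiniteIntegral_iff_ofReal (ae_of_all _ fun ω => sq_nonneg _)]
    exact hlin.trans_lt ENNReal.ofReal_lt_top
  refine ⟨hint, le_trans ?_ hle⟩
  rw [lsVariance, integral_eq_lintegral_of_nonneg_ae (ae_of_all _ fun ω => sq_nonneg _)
    hm.aestronglyMeasurable]
  refine ENNReal.toReal_le_of_le_ofReal ?_ hlin
  have : (0 : ℝ) < ((k + 1 + 1 : ℕ) : ℝ) - 2 - 4 := by linarith
  positivity

end AR1

theorem theorem2 {Ω : Type*} [MeasurableSpace Ω] (μ : Measure Ω) [IsProbabilityMeasure μ]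
    (a₀ : ℝ) (ha₀ : 1 < |a₀|) (σ : ℝ≥0) (hσ : 0 < σ) (e y : ℕ → Ω → ℝ)
    (hy : AR1.IsProcess μ a₀ σ e y) :
    (∀ ε : ℝ, 0 < ε → ∀ N : ℕ, 2 ≤ N →
      μ.real {ω | AR1.lsEstimate y N ω - a₀ > ε} ≤
        ((AR1.root₂ a₀ ε - AR1.root₁ a₀ ε) /
          ((AR1.root₂ a₀ ε - 1) * AR1.root₁ a₀ ε ^ N -
            (AR1.root₁ a₀ ε - 1) * AR1.root₂ a₀ ε ^ N)) ^ (1 / 4 : ℝ)) ∧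
    (∀ N : ℕ, 7 ≤ N →
      Integrable (fun ω => (AR1.lsEstimate y N ω - a₀) ^ 2) μ ∧
      AR1.lsVariance μ a₀ y N ≤
        |a₀| ^ (-(2 * (N : ℝ) / 5)) *
          (2 * a₀ ^ 4 * ((N : ℝ) + 5) / N +
            8 * ((N : ℝ) / ((N : ℝ) + 5)) ^ (1 / 4 : ℝ) *
              (a₀ ^ 2 / ((N : ℝ) - 6) - 1 / ((N : ℝ) + 2)))) ∧
    (∃ C : ℝ, ∀ N : ℕ, 7 ≤ N →
      AR1.lsVariance μ a₀ y N ≤ C * |a₀| ^ (-(2 * (N : ℝ) / 5))) := by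
  have hb : 1 < a₀ ^ 2 := (one_lt_sq_iff_one_lt_abs _).2 ha₀
  refine ⟨fun ε hε N hN => ?_, fun N hN => hy.variance_bound ha₀ hσ hN,
    4 * a₀ ^ 4 + 8 * a₀ ^ 2, fun N hN => (hy.variance_bound ha₀ hσ hN).2.trans ?_⟩
  · obtain ⟨n, rfl⟩ : ∃ n, N = n + 1 := ⟨N - 1, by omega⟩
    rw [AR1.roots_quotient (by linarith) hε]
    have := AR1.gramDet_pos (a := a₀) (sq_nonneg ε) n
    exact ENNReal.toReal_le_of_le_ofReal (by positivity) (hy.measure_error_gt hσ hε n)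
  · rw [mul_comm]
    have hN' : (7 : ℝ) ≤ N := by exact_mod_cast hN
    have hN6 : (0 : ℝ) < N - 6 := by linarith
    have hq : ((N : ℝ) / (N + 5)) ^ (1 / 4 : ℝ) ≤ 1 :=
      Real.rpow_le_one (by positivity) ((div_le_one (by positivity)).2 (by linarith)) (by norm_num)
    have hle : a₀ ^ 2 / ((N : ℝ) - 6) - 1 / ((N : ℝ) + 2) ≤ a₀ ^ 2 := by
      have h1 : a₀ ^ 2 / ((N : ℝ) - 6) ≤ a₀ ^ 2 := div_le_self (by linarith) (by linarith)
      have h2 : (0 : ℝ) < 1 / ((N : ℝ) + 2) := by positivity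
      linarith
    refine mul_le_mul_of_nonneg_right (add_le_add ?_ ?_) (by positivity)
    · rw [div_le_iff₀ (by linarith)]
      nlinarith [show 0 ≤ a₀ ^ 4 by positivity]
    · calc 8 * ((N : ℝ) / (N + 5)) ^ (1 / 4 : ℝ) *
            (a₀ ^ 2 / ((N : ℝ) - 6) - 1 / ((N : ℝ) + 2))
          ≤ 8 * ((N : ℝ) / (N + 5)) ^ (1 / 4 : ℝ) * a₀ ^ 2 := by gcongr
        _ ≤ 8 * 1 * a₀ ^ 2 := by gcongr
        _ = 8 * a₀ ^ 2 := by ring
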